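/- Theorem 1.2. Let $n\in\mathbb{N}$ and let $F:\mathbb{R}^n\to\mathbb{R}$ be a polynomial, $F(x)=\sum_{\ell}\alpha_\ell x^\ell$, where $\ell=(\ell_1,\dots,\ell_n)$ ranges over (finitely many) multi-indices, $\alpha_\ell\in\mathbb{R}$, and $|\ell|=\ell_1+\dots+\ell_n$. Assume that there exists $\ell$ with $|\ell|>0$ and $\alpha_\ell\notin\mathbb{Q}$. Then $F \bmod 1(\mathbb{Z}^n)$ is equidistributed, that is: for $R>0$ let $\sigma_R$ be the normalized counting measure (uniform probability measure) on the set $\mathbb{Z}^n\cap B_R(0)$, where $B_R(0)$ is the Euclidean ball of radius $R$ around the origin in $\mathbb{R}^n$; let $F\bmod 1:\mathbb{R}^n\to\mathbb{R}/\mathbb{Z}$ be the composition of $F$ with the quotient map; and let $\lambda$ be the Haar probability measure on $\mathbb{R}/\mathbb{Z}$. Then $$\lim_{R\to\infty}(F\bmod 1)_*\sigma_R=\lambda$$ in the sense of weak convergence of measures. -/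

import Mathlib

open MeasureTheory Filter
open scoped Topology

noncomputable section

/-- The set of integer points of the Euclidean ball `B_R(0)` in `ℝⁿ`. -/
def latticeBall (n : ℕ) (R : ℝ) : Set (EuclideanSpace ℝ (Fin n)) :=
  {x | x ∈ Metric.ball 0 R ∧ ∀ i, ∃ m : ℤ, x i = (m : ℝ)}

/-- The normalized counting measure `σ_R` on the integer points of `B_R(0)`: a probability measure
for every `R > 0` (and the zero measure for `R ≤ 0`, where the ball is empty). -/
def latticeMeasure (n : ℕ) (R : ℝ) : FiniteMeasure (EuclideanSpace ℝ (Fin n)) :=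
  ⟨ProbabilityTheory.uniformOn (latticeBall n R), by
    unfold ProbabilityTheory.uniformOn; infer_instance⟩

/-- The composition `F mod 1` of `F` with the quotient map `ℝ → ℝ/ℤ`. -/
def modOne {n : ℕ} (F : EuclideanSpace ℝ (Fin n) → ℝ) (x : EuclideanSpace ℝ (Fin n)) :
    UnitAddCircle :=
  (F x : UnitAddCircle)

/-- The Haar probability measure on the circle `ℝ/ℤ`. -/
def circleHaar : FiniteMeasure UnitAddCircle :=
  ⟨AddCircle.haarAddCircle, inferInstance⟩

/-- `F mod 1 (ℤⁿ)` is equidistributed: the push-forwards `(F mod 1)_* σ_R` converge to the Haar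
probability measure as `R → ∞` through the reals, in the topology of weak convergence. -/
def EquidistributedModOne {n : ℕ} (F : EuclideanSpace ℝ (Fin n) → ℝ) : Prop :=
  Tendsto (fun R : ℝ => (latticeMeasure n R).map (modOne F)) atTop (𝓝 circleHaar)

/-- The polynomial function `ℝⁿ → ℝ` given by `x ↦ ∑ ℓ, α_ℓ x^ℓ`, where `α_ℓ = P.coeff ℓ`. -/
def polyFun {n : ℕ} (P : MvPolynomial (Fin n) ℝ) (x : EuclideanSpace ℝ (Fin n)) : ℝ :=
  MvPolynomial.eval (fun i => x i) P

end

/-! By Weyl's criterion it suffices that ball averages of `exp (2πi k P x)` tend to 0 for each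
integer `k ≠ 0`; as `kP` satisfies the same hypothesis, only `k = 1` matters
(`tendsto_ballAverage_polyPhase`). Two facts carry this. Bounded functions have averages that are
asymptotically invariant under a unit shift, because the boundary of the ball is negligible
(`tendsto_card_boundary_div_card`). Van der Corput's inequality bounds an average by correlations of
its shifts (`tendsto_ballAverage_zero_of_differences`).

Induct on the highest degree of an irrational coefficient. Differencing along a coordinate occurring
in such a monomial lowers that degree by exactly one, and the correlations of the phase are phases
of the differences. In degree one, shifting by a common denominator of the rational coefficients
multiplies the phase by a constant `c ≠ 1`; shift invariance then forces `(c - 1)` times the average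
to 0. -/

/-! ### Counting lattice points in balls -/

/-- The integer points of the open Euclidean ball of radius `R` around the origin. -/
noncomputable def ballPoints (n : ℕ) (R : ℝ) : Finset (Fin n → ℤ) :=
  (Fintype.piFinset fun _ => Finset.Icc (-⌊R⌋) ⌊R⌋).filter
    fun x => ((∑ j, x j ^ 2 : ℤ) : ℝ) < R ^ 2

lemma abs_le_floor_of_sum_sq_lt {n : ℕ} {R : ℝ} (hR : 0 ≤ R) {x : Fin n → ℤ}
    (hx : ((∑ j, x j ^ 2 : ℤ) : ℝ) < R ^ 2) (j : Fin n) : x j ∈ Finset.Icc (-⌊R⌋) ⌊R⌋ := by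
  have h1 : x j ^ 2 ≤ ∑ j, x j ^ 2 :=
    Finset.single_le_sum (f := fun j => x j ^ 2) (fun _ _ => sq_nonneg _) (Finset.mem_univ j)
  have h2 : ((x j : ℝ)) ^ 2 ≤ R ^ 2 := by
    have : ((x j ^ 2 : ℤ) : ℝ) ≤ ((∑ j, x j ^ 2 : ℤ) : ℝ) := by exact_mod_cast h1
    push_cast at this hx ⊢
    linarith
  have h3 := abs_le_of_sq_le_sq' h2 hR
  rw [Finset.mem_Icc, neg_le]
  refine ⟨Int.le_floor.2 ?_, Int.le_floor.2 h3.2⟩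
  push_cast
  linarith [h3.1]

lemma mem_ballPoints {n : ℕ} {R : ℝ} (hR : 0 ≤ R) {x : Fin n → ℤ} :
    x ∈ ballPoints n R ↔ ((∑ j, x j ^ 2 : ℤ) : ℝ) < R ^ 2 := by
  rw [ballPoints, Finset.mem_filter, Fintype.mem_piFinset]
  exact ⟨fun h => h.2, fun h => ⟨fun j => abs_le_floor_of_sum_sq_lt hR h j, h⟩⟩

lemma sum_sq_add_single {n : ℕ} (x : Fin n → ℤ) (i : Fin n) (s : ℤ) :
    ∑ j, (x + Pi.single i s : Fin n → ℤ) j ^ 2 = ∑ j, x j ^ 2 + (2 * s * x i + s ^ 2) := by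
  have h : ∀ j, (x + Pi.single i s : Fin n → ℤ) j ^ 2
      = x j ^ 2 + (if j = i then 2 * s * x i + s ^ 2 else 0) := by
    intro j
    by_cases hj : j = i
    · subst hj; simp; ring
    · simp [hj]
  simp_rw [h, Finset.sum_add_distrib]
  simp

/-- A cube of half-side `r` fits in the ball as soon as `n * r ^ 2 < R ^ 2`. Dividing `R` by `n + 1`
ensures this without square roots, also for `n = 0`. -/
lemma card_ballPoints_ge {n : ℕ} {R : ℝ} (hR : 0 < R) :
    (2 * ⌊R / (n + 1)⌋₊ + 1) ^ n ≤ (ballPoints n R).card := by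
  set r := ⌊R / (n + 1)⌋₊ with hr
  have hr' : (r : ℝ) * (n + 1) ≤ R := by
    rw [← le_div_iff₀ (by positivity)]
    exact Nat.floor_le (by positivity)
  have hcard : (Fintype.piFinset fun _ : Fin n => Finset.Icc (-(r : ℤ)) r).card
      = (2 * r + 1) ^ n := by
    rw [Fintype.card_piFinset]
    simp only [Int.card_Icc, Finset.prod_const, Finset.card_univ, Fintype.card_fin]
    congr 1
    omega
  rw [← hcard]
  refine Finset.card_le_card fun x hx => ?_
  rw [mem_ballPoints hR.le]
  rw [Fintype.mem_piFinset] at hx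
  have h1 : ∑ j, x j ^ 2 ≤ n * (r : ℤ) ^ 2 := by
    calc ∑ j, x j ^ 2 ≤ ∑ _j : Fin n, (r : ℤ) ^ 2 := by
          refine Finset.sum_le_sum fun j _ => ?_
          have := Finset.mem_Icc.1 (hx j)
          exact sq_le_sq' this.1 this.2
      _ = _ := by simp
  have h2 : ((∑ j, x j ^ 2 : ℤ) : ℝ) ≤ n * (r : ℝ) ^ 2 := by exact_mod_cast h1
  refine h2.trans_lt ?_
  have hn : (0 : ℝ) ≤ n := Nat.cast_nonneg n
  have hr0 : (0 : ℝ) ≤ r := Nat.cast_nonneg r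
  rcases hr0.eq_or_lt with h | h
  · rw [← h]
    simpa using pow_pos hR 2
  · have h3 : ((r : ℝ) * (n + 1)) ^ 2 ≤ R ^ 2 := by gcongr
    have h4 : (0 : ℝ) < (r : ℝ) ^ 2 := by positivity
    nlinarith

lemma ballPoints_card_pos {n : ℕ} {R : ℝ} (hR : 0 < R) : 0 < (ballPoints n R).card :=
  lt_of_lt_of_le (by positivity) (card_ballPoints_ge hR)

/-- By convexity a line in direction `i` leaves the ball at most once, so erasing coordinate `i` is
injective on the exit points. -/
lemma card_ballPoints_boundary_le {n : ℕ} {R : ℝ} (hR : 0 < R) (i : Fin n) :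
    ((ballPoints n R).filter fun x => x + Pi.single i 1 ∉ ballPoints n R).card
      ≤ (2 * ⌊R⌋₊ + 1) ^ (n - 1) := by
  have hcard : (Fintype.piFinset fun j : Fin n =>
      if j = i then {0} else Finset.Icc (-⌊R⌋) ⌊R⌋).card = (2 * ⌊R⌋₊ + 1) ^ (n - 1) := by
    rw [Fintype.card_piFinset, ← Finset.mul_prod_erase _ _ (Finset.mem_univ i)]
    have h : ∀ j ∈ Finset.univ.erase i,
        (if j = i then ({0} : Finset ℤ) else Finset.Icc (-⌊R⌋) ⌊R⌋).card = 2 * ⌊R⌋₊ + 1 := by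
      intro j hj
      rw [if_neg (Finset.ne_of_mem_erase hj), Int.card_Icc]
      have := Int.natCast_floor_eq_floor hR.le
      omega
    rw [Finset.prod_congr rfl h]
    simp
  rw [← hcard]
  refine Finset.card_le_card_of_injOn (fun x => Function.update x i 0) ?_ ?_
  · intro x hx
    have hx' := (mem_ballPoints hR.le).1 (Finset.mem_filter.1 hx).1
    simp only [Finset.mem_coe, Fintype.mem_piFinset]
    intro j
    by_cases hj : j = i
    · subst hj; simp
    · simpa [hj] using Finset.mem_Icc.1 (abs_le_floor_of_sum_sq_lt hR.le hx' j)
  -- A point that leaves the ball at shift 1 has `x i ≥ 0`, so further shifts only increase the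
  -- norm.
  · have key : ∀ x ∈ (ballPoints n R).filter fun x => x + Pi.single i 1 ∉ ballPoints n R,
        ∀ s : ℤ, 0 < s → x + Pi.single i s ∉ ballPoints n R := by
      intro x hx s hs
      rw [Finset.mem_filter] at hx
      simp only [mem_ballPoints hR.le, sum_sq_add_single] at hx ⊢
      obtain ⟨h1, h2⟩ := hx
      rw [not_lt] at h2 ⊢
      have h3 : (0 : ℤ) < 2 * 1 * x i + 1 ^ 2 := by
        have : ((∑ j, x j ^ 2 : ℤ) : ℝ) <
          ((∑ j, x j ^ 2 + (2 * 1 * x i + 1 ^ 2) : ℤ) : ℝ) := h1.trans_le h2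
        have := Int.cast_lt.1 this
        omega
      have h4 : 0 ≤ x i := by omega
      refine h2.trans (Int.cast_le.2 ?_)
      nlinarith
    intro x hx y hy hxy
    have hne : ∀ j, j ≠ i → x j = y j := fun j hj => by
      simpa [hj] using congrFun hxy j
    have hsub : ∀ u v : Fin n → ℤ, (∀ j, j ≠ i → u j = v j) → v = u + Pi.single i (v i - u i) := by
      intro u v h
      ext j
      by_cases hj : j = i
      · subst hj; simp
      · simp [hj, h j hj]
    rcases lt_trichotomy (x i) (y i) with h | h | h
    · refine absurd (Finset.mem_filter.1 hy).1 ?_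
      rw [hsub x y hne]
      exact key x hx _ (by omega)
    · ext j
      by_cases hj : j = i
      · subst hj; exact h
      · exact hne j hj
    · refine absurd (Finset.mem_filter.1 hx).1 ?_
      rw [hsub y x fun j hj => (hne j hj).symm]
      exact key y hy _ (by omega)

lemma tendsto_card_boundary_div_card {n : ℕ} (i : Fin n) :
    Tendsto (fun R : ℝ =>
      (((ballPoints n R).filter fun x => x + Pi.single i 1 ∉ ballPoints n R).card : ℝ) /
        (ballPoints n R).card) atTop (𝓝 0) := by
  have hlim : Tendsto (fun R : ℝ =>
      (3 * ((n : ℝ) + 1)) ^ (n - 1) / (2 * (⌊R / (n + 1)⌋₊ : ℝ) + 1)) atTop (𝓝 0) := by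
    refine Tendsto.div_atTop tendsto_const_nhds ?_
    refine tendsto_atTop_add_const_right _ _ (Tendsto.const_mul_atTop two_pos ?_)
    exact tendsto_natCast_atTop_atTop.comp
      (tendsto_nat_floor_atTop.comp (tendsto_id.atTop_div_const (by positivity)))
  refine squeeze_zero' (Eventually.of_forall fun R => by positivity) ?_ hlim
  filter_upwards [eventually_gt_atTop 0] with R hR
  set r := ⌊R / (n + 1)⌋₊ with hr
  have h1 : (((ballPoints n R).filter fun x => x + Pi.single i 1 ∉ ballPoints n R).card : ℝ)
      ≤ (2 * (⌊R⌋₊ : ℝ) + 1) ^ (n - 1) := by exact_mod_cast card_ballPoints_boundary_le hR i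
  have h2 : (2 * (r : ℝ) + 1) ^ n ≤ (ballPoints n R).card := by
    have := card_ballPoints_ge (n := n) hR
    rw [← hr] at this
    exact_mod_cast this
  -- The sides of the outer and inner cubes are comparable, so the ratio is at most a constant over
  -- the inner side.
  have h3 : 2 * (⌊R⌋₊ : ℝ) + 1 ≤ 3 * ((n : ℝ) + 1) * (2 * r + 1) := by
    have ha : R < (r + 1) * (n + 1) := by
      rw [← div_lt_iff₀ (by positivity)]
      exact Nat.lt_floor_add_one _
    have hb : (⌊R⌋₊ : ℝ) ≤ R := Nat.floor_le hR.le
    have hn : (0 : ℝ) ≤ n := Nat.cast_nonneg n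
    have hr0 : (0 : ℝ) ≤ r := Nat.cast_nonneg r
    nlinarith [mul_nonneg hn hr0]
  have hpow : (2 * (r : ℝ) + 1) ^ n = (2 * (r : ℝ) + 1) ^ (n - 1) * (2 * r + 1) := by
    rw [← pow_succ, Nat.sub_add_cancel i.pos]
  rw [div_le_div_iff₀ (by exact_mod_cast ballPoints_card_pos hR) (by positivity)]
  calc _ ≤ (3 * ((n : ℝ) + 1) * (2 * r + 1)) ^ (n - 1) * (2 * r + 1) := by
        gcongr
        exact h1.trans (by gcongr)
    _ = (3 * ((n : ℝ) + 1)) ^ (n - 1) * (2 * (r : ℝ) + 1) ^ n := by rw [hpow, mul_pow]; ring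
    _ ≤ _ := by gcongr

/-! ### Ball averages, shift invariance and van der Corput's inequality -/

/-- The average of `g` over the integer points of the ball of radius `R`. -/
noncomputable def ballAverage {n : ℕ} (g : (Fin n → ℤ) → ℂ) (R : ℝ) : ℂ :=
  ((ballPoints n R).card : ℂ)⁻¹ * ∑ x ∈ ballPoints n R, g x

lemma ballAverage_sum {n : ℕ} {ι : Type*} (s : Finset ι) (g : ι → (Fin n → ℤ) → ℂ) (R : ℝ) :
    ballAverage (fun x => ∑ t ∈ s, g t x) R = ∑ t ∈ s, ballAverage (g t) R := by
  simp only [ballAverage]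
  rw [Finset.sum_comm, Finset.mul_sum]

lemma ballAverage_const_mul {n : ℕ} (c : ℂ) (g : (Fin n → ℤ) → ℂ) (R : ℝ) :
    ballAverage (fun x => c * g x) R = c * ballAverage g R := by
  simp only [ballAverage, ← Finset.mul_sum]
  ring

lemma ballAverage_const {n : ℕ} (c : ℂ) {R : ℝ} (hR : 0 < R) :
    ballAverage (fun _ : Fin n → ℤ => c) R = c := by
  have : ((ballPoints n R).card : ℂ) ≠ 0 := by exact_mod_cast (ballPoints_card_pos hR).ne'
  simp [ballAverage, this]

/-- Cauchy–Schwarz, with `|g|²` written as a product so that it expands into correlations when `g`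
is a sum of shifts. -/
lemma norm_ballAverage_sq_le {n : ℕ} (g : (Fin n → ℤ) → ℂ) {R : ℝ} (hR : 0 < R) :
    ‖ballAverage g R‖ ^ 2 ≤ ‖ballAverage (fun x => g x * starRingEnd ℂ (g x)) R‖ := by
  have hc : (0 : ℝ) < (ballPoints n R).card := by exact_mod_cast ballPoints_card_pos hR
  have h1 : ∑ x ∈ ballPoints n R, g x * starRingEnd ℂ (g x)
      = ((∑ x ∈ ballPoints n R, ‖g x‖ ^ 2 : ℝ) : ℂ) := by
    push_cast
    exact Finset.sum_congr rfl fun x _ => Complex.mul_conj' (g x)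
  have h2 : ‖∑ x ∈ ballPoints n R, g x‖ ^ 2
      ≤ (ballPoints n R).card * ∑ x ∈ ballPoints n R, ‖g x‖ ^ 2 :=
    (pow_le_pow_left₀ (norm_nonneg _) (norm_sum_le _ _) 2).trans sq_sum_le_card_mul_sum_sq
  simp only [ballAverage]
  rw [h1, norm_mul, norm_mul, norm_inv, Complex.norm_natCast, Complex.norm_real,
    Real.norm_of_nonneg (Finset.sum_nonneg fun _ _ => sq_nonneg _), mul_pow, inv_pow]
  calc _ ≤ (((ballPoints n R).card : ℝ) ^ 2)⁻¹ *
        ((ballPoints n R).card * ∑ x ∈ ballPoints n R, ‖g x‖ ^ 2) := by gcongr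
    _ = _ := by field_simp

/-- Only the symmetric difference of `A` and its translate contributes, and its two halves have
equal size. -/
lemma norm_sum_add_single_sub_sum_le {n : ℕ} (i : Fin n) {g : (Fin n → ℤ) → ℂ} {C : ℝ}
    (hg : ∀ x, ‖g x‖ ≤ C) (A : Finset (Fin n → ℤ)) :
    ‖∑ x ∈ A, g (x + Pi.single i 1) - ∑ x ∈ A, g x‖
      ≤ 2 * C * (A.filter fun x => x + Pi.single i 1 ∉ A).card := by
  classical
  set e := addRightEmbedding (Pi.single i 1 : Fin n → ℤ) with he
  have hsum : ∑ x ∈ A, g (x + Pi.single i 1) = ∑ x ∈ A.map e, g x := by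
    rw [Finset.sum_map]; rfl
  have hsd : A.map e \ A = (A.filter fun x => x + Pi.single i 1 ∉ A).map e := by
    ext y
    simp only [Finset.mem_sdiff, Finset.mem_map, Finset.mem_filter, he, addRightEmbedding_apply]
    constructor
    · rintro ⟨⟨x, hx, rfl⟩, hy⟩
      exact ⟨x, ⟨hx, hy⟩, rfl⟩
    · rintro ⟨x, ⟨hx, hy⟩, rfl⟩
      exact ⟨⟨x, hx, rfl⟩, hy⟩
  have hc1 : (A.map e \ A).card = (A.filter fun x => x + Pi.single i 1 ∉ A).card := by
    rw [hsd, Finset.card_map]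
  have hc2 : (A \ A.map e).card = (A.filter fun x => x + Pi.single i 1 ∉ A).card := by
    rw [← hc1]
    exact Finset.card_sdiff_comm (by rw [Finset.card_map])
  rw [hsum, ← Finset.sum_sdiff_sub_sum_sdiff]
  have hb : ∀ s : Finset (Fin n → ℤ), ‖∑ x ∈ s, g x‖ ≤ s.card * C := fun s => by
    simpa using norm_sum_le_of_le s fun x _ => hg x
  calc _ ≤ ‖∑ x ∈ A.map e \ A, g x‖ + ‖∑ x ∈ A \ A.map e, g x‖ := norm_sub_le _ _
    _ ≤ _ := by
      have h1 := hb (A.map e \ A)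
      have h2 := hb (A \ A.map e)
      rw [hc1] at h1
      rw [hc2] at h2
      linarith

lemma tendsto_ballAverage_add_single_one {n : ℕ} (i : Fin n) {g : (Fin n → ℤ) → ℂ} {C : ℝ}
    (hg : ∀ x, ‖g x‖ ≤ C) :
    Tendsto (fun R => ballAverage (fun x => g (x + Pi.single i 1)) R - ballAverage g R)
      atTop (𝓝 0) := by
  have h0 := (tendsto_card_boundary_div_card i).const_mul (2 * C)
  rw [mul_zero] at h0
  refine squeeze_zero_norm (fun R => ?_) h0
  simp only [ballAverage]
  rw [← mul_sub, norm_mul, norm_inv, Complex.norm_natCast]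
  refine (mul_le_mul_of_nonneg_left (norm_sum_add_single_sub_sum_le i hg _)
    (by positivity)).trans_eq ?_
  rw [inv_mul_eq_div, mul_div_assoc]

lemma tendsto_ballAverage_add_single_nat {n : ℕ} (i : Fin n) {g : (Fin n → ℤ) → ℂ} {C : ℝ}
    (hg : ∀ x, ‖g x‖ ≤ C) (t : ℕ) :
    Tendsto (fun R => ballAverage (fun x => g (x + Pi.single i (t : ℤ))) R - ballAverage g R)
      atTop (𝓝 0) := by
  induction t with
  | zero => simp
  | succ t ih =>
    have h := (tendsto_ballAverage_add_single_one i
      (g := fun x => g (x + Pi.single i (t : ℤ))) fun x => hg _).add ih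
    rw [add_zero] at h
    refine h.congr fun R => ?_
    rw [sub_add_sub_cancel]
    simp only [add_assoc, ← Pi.single_add]
    simp only [Nat.cast_add, Nat.cast_one, add_comm (1 : ℤ)]

/-- **Van der Corput's difference theorem** for averages over the integer points of balls, with
differences in one coordinate direction. -/
theorem tendsto_ballAverage_zero_of_differences {n : ℕ} (i : Fin n) {f : (Fin n → ℤ) → ℂ}
    (hf : ∀ x, ‖f x‖ = 1)
    (h : ∀ s t : ℕ, s ≠ t → Tendsto (ballAverage fun x =>
      f (x + Pi.single i (s : ℤ)) * starRingEnd ℂ (f (x + Pi.single i (t : ℤ)))) atTop (𝓝 0)) :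
    Tendsto (ballAverage f) atTop (𝓝 0) := by
  -- Sum over `k ^ 2` shifts: only the diagonal correlations survive, so the mean of `|S|²` tends to
  -- `k ^ 2` and `k ^ 2 * ‖ballAverage f R‖ ≤ k + 2 ≤ 3 * k` eventually. Taking a square number of
  -- shifts avoids roots.
  have key : ∀ k : ℕ, 0 < k → ∀ᶠ R in atTop, ‖ballAverage f R‖ ≤ 3 / k := by
    intro k hk
    set S : (Fin n → ℤ) → ℂ := fun x => ∑ t ∈ Finset.range (k ^ 2), f (x + Pi.single i (t : ℤ))
      with hS
    have h1 : Tendsto (fun R => ballAverage S R - (k : ℂ) ^ 2 * ballAverage f R)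
        atTop (𝓝 0) := by
      have := tendsto_finsetSum (Finset.range (k ^ 2)) fun t _ =>
        tendsto_ballAverage_add_single_nat i (fun x => (hf x).le) t
      rw [Finset.sum_const_zero] at this
      refine this.congr fun R => ?_
      rw [Finset.sum_sub_distrib, hS, ballAverage_sum]
      simp
    have h2 : Tendsto (ballAverage fun x => S x * starRingEnd ℂ (S x))
        atTop (𝓝 ((k : ℂ) ^ 2)) := by
      have : Tendsto (fun R => ∑ s ∈ Finset.range (k ^ 2), ∑ t ∈ Finset.range (k ^ 2),
          ballAverage (fun x => f (x + Pi.single i (s : ℤ)) *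
            starRingEnd ℂ (f (x + Pi.single i (t : ℤ)))) R) atTop
          (𝓝 (∑ s ∈ Finset.range (k ^ 2), ∑ t ∈ Finset.range (k ^ 2), if s = t then 1 else 0)) := by
        refine tendsto_finsetSum _ fun s _ => tendsto_finsetSum _ fun t _ => ?_
        split_ifs with hst
        · subst hst
          refine tendsto_const_nhds.congr' ?_
          filter_upwards [eventually_gt_atTop 0] with R hR
          simp_rw [Complex.mul_conj', hf]
          rw [ballAverage_const _ hR]
          simp
        · exact h s t hst
      have hval : (∑ s ∈ Finset.range (k ^ 2), ∑ t ∈ Finset.range (k ^ 2),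
          if s = t then (1 : ℂ) else 0) = (k : ℂ) ^ 2 := by
        rw [Finset.sum_congr rfl fun s hs => by rw [Finset.sum_ite_eq, if_pos hs]]
        simp
      rw [hval] at this
      refine this.congr fun R => ?_
      simp_rw [← ballAverage_sum]
      congr 1
      ext x
      rw [hS, map_sum, Finset.sum_mul_sum]
    have h1' := (tendsto_zero_iff_norm_tendsto_zero.1 h1).eventually_lt_const one_pos
    have hk1 : (1 : ℝ) ≤ k := by exact_mod_cast hk
    have h2' := h2.norm.eventually_lt_const (u := ((k : ℝ) + 1) ^ 2) (by
      rw [norm_pow, Complex.norm_natCast]; nlinarith)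
    filter_upwards [h1', h2', eventually_gt_atTop 0] with R hR1 hR2 hR
    have h3 : ‖ballAverage S R‖ ≤ k + 1 :=
      le_of_sq_le_sq ((norm_ballAverage_sq_le S hR).trans hR2.le) (by positivity)
    have h4 : ‖(k : ℂ) ^ 2 * ballAverage f R‖ ≤ (k + 1) + 1 := by
      have := norm_sub_norm_le ((k : ℂ) ^ 2 * ballAverage f R) (ballAverage S R)
      rw [norm_sub_rev] at this
      linarith
    rw [norm_mul, norm_pow, Complex.norm_natCast] at h4
    rw [le_div_iff₀ (by positivity)]
    by_contra! hlt
    nlinarith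
  rw [tendsto_zero_iff_norm_tendsto_zero, Metric.tendsto_nhds]
  intro ε hε
  obtain ⟨k, hk⟩ := exists_nat_gt (3 / ε)
  have hk0 : (0 : ℝ) < k := lt_trans (by positivity) hk
  filter_upwards [key k (by exact_mod_cast hk0)] with R hR
  rw [dist_zero_right, norm_norm]
  refine hR.trans_lt ?_
  rw [div_lt_iff₀ hε] at hk
  rw [div_lt_iff₀ hk0]
  linarith

/-! ### Differences of polynomials and their irrational coefficients -/

/-- The difference `P (y + t eᵢ) - P y` of a polynomial in the direction of the `i`-th coordinate,
as a polynomial in `y`. -/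
noncomputable def MvPolynomial.directionalDifference {n : ℕ} (i : Fin n) (t : ℝ)
    (P : MvPolynomial (Fin n) ℝ) : MvPolynomial (Fin n) ℝ :=
  -- Binomial expansion without the cancelling term `k = ℓ i`, so every monomial visibly drops in
  -- degree.
  ∑ ℓ ∈ P.support, ∑ k ∈ Finset.range (ℓ i),
    MvPolynomial.monomial (ℓ.update i k) (P.coeff ℓ * ((ℓ i).choose k * t ^ (ℓ i - k)))

lemma prod_add_single_pow_sub_prod_pow {σ S : Type*} [Fintype σ] [DecidableEq σ] [CommRing S]
    (i : σ) (t : S) (y : σ → S) (ℓ : σ →₀ ℕ) :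
    ∏ j, (y + Pi.single i t : σ → S) j ^ ℓ j - ∏ j, y j ^ ℓ j
      = ((y i + t) ^ ℓ i - y i ^ ℓ i) * ∏ j ∈ Finset.univ.erase i, y j ^ ℓ j := by
  rw [← Finset.mul_prod_erase _ _ (Finset.mem_univ i),
    ← Finset.mul_prod_erase _ (fun j => y j ^ ℓ j) (Finset.mem_univ i), sub_mul]
  congr 2
  · simp
  · refine Finset.prod_congr rfl fun j hj => ?_
    simp [Finset.ne_of_mem_erase hj]

lemma MvPolynomial.eval_directionalDifference {n : ℕ} (i : Fin n) (t : ℝ)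
    (P : MvPolynomial (Fin n) ℝ) (y : Fin n → ℝ) :
    MvPolynomial.eval y (P.directionalDifference i t)
      = MvPolynomial.eval (y + Pi.single i t) P - MvPolynomial.eval y P := by
  rw [MvPolynomial.eval_eq' _ P, MvPolynomial.eval_eq' _ P, ← Finset.sum_sub_distrib,
    MvPolynomial.directionalDifference, map_sum]
  refine Finset.sum_congr rfl fun ℓ _ => ?_
  rw [← mul_sub, prod_add_single_pow_sub_prod_pow, map_sum, add_pow, Finset.sum_range_succ]
  simp only [Nat.sub_self, pow_zero, Nat.choose_self, Nat.cast_one, mul_one, add_sub_cancel_right]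
  rw [Finset.sum_mul, Finset.mul_sum]
  refine Finset.sum_congr rfl fun k _ => ?_
  have hprod : ∏ j, y j ^ (ℓ.update i k) j
      = y i ^ k * ∏ j ∈ Finset.univ.erase i, y j ^ ℓ j := by
    rw [← Finset.mul_prod_erase _ _ (Finset.mem_univ i)]
    congr 1
    · simp
    · refine Finset.prod_congr rfl fun j hj => ?_
      simp [Finsupp.update_apply, Finset.ne_of_mem_erase hj]
  rw [MvPolynomial.eval_monomial, Finsupp.prod_fintype _ _ (fun _ => pow_zero _), hprod]
  ring

lemma MvPolynomial.coeff_directionalDifference {n : ℕ} (i : Fin n) (t : ℝ)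
    (P : MvPolynomial (Fin n) ℝ) (m : Fin n →₀ ℕ) :
    (P.directionalDifference i t).coeff m = ∑ ℓ ∈ P.support, ∑ k ∈ Finset.range (ℓ i),
      if ℓ.update i k = m then P.coeff ℓ * ((ℓ i).choose k * t ^ (ℓ i - k)) else 0 := by
  rw [MvPolynomial.directionalDifference, MvPolynomial.coeff_sum]
  simp_rw [MvPolynomial.coeff_sum, MvPolynomial.coeff_monomial]

lemma Finsupp.degree_update_add {n : ℕ} (ℓ : Fin n →₀ ℕ) (i : Fin n) (k : ℕ) :
    (ℓ.update i k).degree + ℓ i = ℓ.degree + k := by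
  have h : ∀ m : Fin n →₀ ℕ, m.degree = m i + ∑ j ∈ Finset.univ.erase i, m j := fun m => by
    rw [Finsupp.degree_eq_sum, Finset.add_sum_erase _ _ (Finset.mem_univ i)]
  have h' : ∑ j ∈ Finset.univ.erase i, (ℓ.update i k) j = ∑ j ∈ Finset.univ.erase i, ℓ j :=
    Finset.sum_congr rfl fun j hj => by
      simp [Finsupp.update_apply, Finset.ne_of_mem_erase hj]
  rw [h, h ℓ, h']
  simp
  ring

/-- Subfield membership makes closure under sums and products available as `sum_mem` and `mul_mem`.
-/
lemma not_irrational_iff_mem_fieldRange {x : ℝ} :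
    ¬ Irrational x ↔ x ∈ (Rat.castHom ℝ).fieldRange := by
  simp [Irrational, RingHom.mem_fieldRange]

lemma natCast_mem_fieldRange (a : ℕ) : (a : ℝ) ∈ (Rat.castHom ℝ).fieldRange := natCast_mem _ a

lemma intCast_mem_fieldRange (a : ℤ) : (a : ℝ) ∈ (Rat.castHom ℝ).fieldRange := intCast_mem _ a

/-- If the coefficients of `P` in degrees above `d + 1` are rational, then so are those of its
differences in degrees above `d`. -/
lemma MvPolynomial.not_irrational_coeff_directionalDifference {n : ℕ} (i : Fin n) (t : ℤ)
    {P : MvPolynomial (Fin n) ℝ} {d : ℕ}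
    (hP : ∀ ℓ : Fin n →₀ ℕ, d + 1 < ℓ.degree → ¬ Irrational (P.coeff ℓ))
    {m : Fin n →₀ ℕ} (hm : d < m.degree) :
    ¬ Irrational ((P.directionalDifference i t).coeff m) := by
  rw [not_irrational_iff_mem_fieldRange, MvPolynomial.coeff_directionalDifference]
  refine sum_mem fun ℓ _ => sum_mem fun k hk => ?_
  split_ifs with h
  · refine mul_mem (not_irrational_iff_mem_fieldRange.1 (hP ℓ ?_))
      (mul_mem (natCast_mem_fieldRange _) (pow_mem (intCast_mem_fieldRange _) _))
    have := Finsupp.degree_update_add ℓ i k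
    rw [h] at this
    have := Finset.mem_range.1 hk
    omega
  · exact zero_mem _

/-- The term from `ℓ` is `P.coeff ℓ * ℓ i * t`. Any other `ℓ'` reaching the same monomial agrees
with `ℓ` off `i` and has `ℓ' i > ℓ i`, hence degree above `d + 1` and a rational coefficient: no
cancellation of the irrational part is possible. -/
lemma MvPolynomial.irrational_coeff_directionalDifference {n : ℕ} (i : Fin n) {t : ℤ}
    (ht : t ≠ 0) {P : MvPolynomial (Fin n) ℝ} {d : ℕ}
    (hP : ∀ ℓ : Fin n →₀ ℕ, d + 1 < ℓ.degree → ¬ Irrational (P.coeff ℓ))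
    {ℓ : Fin n →₀ ℕ} (hd : ℓ.degree = d + 1) (hi : ℓ i ≠ 0) (hℓ : Irrational (P.coeff ℓ)) :
    Irrational ((P.directionalDifference i t).coeff (ℓ.update i (ℓ i - 1))) := by
  have hsupp : ℓ ∈ P.support := MvPolynomial.mem_support_iff.2 fun h => by simp [h] at hℓ
  have hmain : ∀ k ∈ Finset.range (ℓ i), k ≠ ℓ i - 1 →
      (if ℓ.update i k = ℓ.update i (ℓ i - 1) then
        P.coeff ℓ * ((ℓ i).choose k * (t : ℝ) ^ (ℓ i - k)) else 0) = 0 := by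
    intro k _ hk
    refine if_neg fun h => hk ?_
    simpa using DFunLike.congr_fun h i
  rw [MvPolynomial.coeff_directionalDifference, ← Finset.add_sum_erase _ _ hsupp,
    Finset.sum_eq_single_of_mem (ℓ i - 1) (Finset.mem_range.2 (by omega)) hmain, if_pos rfl]
  have hrest : (∑ ℓ' ∈ P.support.erase ℓ, ∑ k ∈ Finset.range (ℓ' i),
      if ℓ'.update i k = ℓ.update i (ℓ i - 1) then
        P.coeff ℓ' * ((ℓ' i).choose k * (t : ℝ) ^ (ℓ' i - k)) else 0)
      ∈ (Rat.castHom ℝ).fieldRange := by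
    refine sum_mem fun ℓ' hℓ' => sum_mem fun k hk => ?_
    split_ifs with h
    · refine mul_mem (not_irrational_iff_mem_fieldRange.1 (hP ℓ' ?_))
        (mul_mem (natCast_mem_fieldRange _) (pow_mem (intCast_mem_fieldRange _) _))
      have h1 := Finsupp.degree_update_add ℓ' i k
      have h2 := Finsupp.degree_update_add ℓ i (ℓ i - 1)
      have h3 := Finset.mem_range.1 hk
      have h4 : k = ℓ i - 1 := by simpa using DFunLike.congr_fun h i
      rw [h] at h1
      by_contra hle
      have h5 : ℓ' i = ℓ i := by omega
      refine Finset.ne_of_mem_erase hℓ' (Finsupp.ext fun j => ?_)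
      by_cases hj : j = i
      · rw [hj, h5]
      · simpa [Finsupp.update_apply, hj] using DFunLike.congr_fun h j
    · exact zero_mem _
  obtain ⟨q, hq⟩ := RingHom.mem_fieldRange.1 hrest
  rw [← hq, show ℓ i - (ℓ i - 1) = 1 by omega, pow_one]
  refine Irrational.add_ratCast q ?_
  rw [← mul_assoc]
  refine Irrational.mul_intCast (Irrational.mul_natCast hℓ ?_) ht
  exact (Nat.choose_pos (Nat.sub_le _ _)).ne'

/-! ### Exponential sums of polynomial phases -/

lemma fourierChar_intCast (z : ℤ) : Real.fourierChar (z : ℝ) = 1 := by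
  apply Circle.ext
  rw [Real.fourierChar_apply, Circle.coe_one, Complex.exp_eq_one_iff]
  exact ⟨z, by push_cast; ring⟩

lemma fourierChar_ne_one_of_irrational {y : ℝ} (hy : Irrational y) : Real.fourierChar y ≠ 1 := by
  intro h
  have h' := congrArg (fun z : Circle => (z : ℂ)) h
  simp only [Real.fourierChar_apply, Circle.coe_one] at h'
  obtain ⟨z, hz⟩ := Complex.exp_eq_one_iff.1 h'
  refine hy ⟨z, ?_⟩
  have h2 : ((2 * Real.pi * Complex.I : ℂ)) ≠ 0 := Complex.two_pi_I_ne_zero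
  have h3 : ((z : ℝ) : ℂ) = (y : ℂ) := by
    apply mul_right_cancel₀ h2
    push_cast at hz ⊢
    rw [← hz]
    ring
  push_cast
  exact_mod_cast h3

/-- The exponential phase `exp (2πi P x)` of a polynomial at integer points. -/
noncomputable def polyPhase {n : ℕ} (P : MvPolynomial (Fin n) ℝ) (x : Fin n → ℤ) : ℂ :=
  (Real.fourierChar (MvPolynomial.eval (fun j => (x j : ℝ)) P) : ℂ)

lemma norm_polyPhase {n : ℕ} (P : MvPolynomial (Fin n) ℝ) (x : Fin n → ℤ) :
    ‖polyPhase P x‖ = 1 := Circle.norm_coe _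

lemma intCast_add_single {n : ℕ} (x : Fin n → ℤ) (i : Fin n) (t : ℤ) :
    (fun j => (((x + Pi.single i t : Fin n → ℤ) j : ℤ) : ℝ))
      = (fun j => (x j : ℝ)) + Pi.single i (t : ℝ) := by
  ext j
  by_cases hj : j = i
  · subst hj; simp
  · simp [hj]

lemma polyPhase_mul_conj {n : ℕ} (P : MvPolynomial (Fin n) ℝ) (i : Fin n) (s t : ℤ)
    (x : Fin n → ℤ) :
    polyPhase P (x + Pi.single i s) * starRingEnd ℂ (polyPhase P (x + Pi.single i t))
      = polyPhase (P.directionalDifference i ((s - t : ℤ) : ℝ)) (x + Pi.single i t) := by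
  simp only [polyPhase]
  rw [MvPolynomial.eval_directionalDifference, ← Circle.coe_inv_eq_conj, ← Circle.coe_mul,
    ← AddChar.map_neg_eq_inv, ← AddChar.map_add_eq_mul, ← sub_eq_add_neg, ← intCast_add_single,
    add_assoc, ← Pi.single_add, add_sub_cancel]

/-- A common denominator for the rational coefficients of a polynomial. -/
lemma MvPolynomial.exists_common_denominator {n : ℕ} (P : MvPolynomial (Fin n) ℝ) :
    ∃ q : ℕ, q ≠ 0 ∧ ∀ ℓ, ¬ Irrational (P.coeff ℓ) →
      (q : ℝ) * P.coeff ℓ ∈ (Int.castRingHom ℝ).range := by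
  have h : ∀ a : ℝ, ∃ q : ℕ, q ≠ 0 ∧ (¬ Irrational a → (q : ℝ) * a ∈ (Int.castRingHom ℝ).range) := by
    intro a
    by_cases ha : Irrational a
    · exact ⟨1, one_ne_zero, fun h => absurd ha h⟩
    · rw [Irrational, not_not] at ha
      obtain ⟨r, rfl⟩ := ha
      refine ⟨r.den, r.den_nz, fun _ => ⟨r.num, ?_⟩⟩
      have := Rat.den_mul_eq_num r
      simpa using (by exact_mod_cast this.symm : (r.num : ℝ) = (r.den : ℝ) * (r : ℝ))
  choose q hq0 hq using h
  refine ⟨∏ ℓ ∈ P.support, q (P.coeff ℓ), Finset.prod_ne_zero_iff.2 fun _ _ => hq0 _,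
    fun ℓ hℓ => ?_⟩
  by_cases hs : ℓ ∈ P.support
  · rw [← Finset.mul_prod_erase _ _ hs]
    push_cast
    rw [mul_right_comm]
    refine mul_mem (hq _ hℓ) (prod_mem fun _ _ => natCast_mem _ _)
  · rw [MvPolynomial.notMem_support_iff.1 hs, mul_zero]
    exact zero_mem _

lemma Finsupp.eq_single_of_degree_le_one {n : ℕ} {ℓ : Fin n →₀ ℕ} {i : Fin n} (hi : ℓ i ≠ 0)
    (hd : ℓ.degree ≤ 1) : ℓ = Finsupp.single i 1 := by
  rw [Finsupp.degree_eq_sum, ← Finset.add_sum_erase _ _ (Finset.mem_univ i)] at hd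
  have h0 : ∑ j ∈ Finset.univ.erase i, ℓ j = 0 := by omega
  ext j
  by_cases hj : j = i
  · subst hj
    rw [Finsupp.single_eq_same]
    omega
  · rw [Finsupp.single_eq_of_ne hj]
    exact Finset.sum_eq_zero_iff.1 h0 j (Finset.mem_erase.2 ⟨hj, Finset.mem_univ j⟩)

/-- Since `q` divides `(x i + q) ^ m - x i ^ m`, each monomial of degree above one changes by an
integer. Monomials free of `x i` do not change, which leaves the linear one. -/
lemma MvPolynomial.eval_add_single_sub_eval_sub_mem {n : ℕ} (P : MvPolynomial (Fin n) ℝ)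
    (i : Fin n) {q : ℕ} (hq : ∀ ℓ : Fin n →₀ ℕ, 1 < ℓ.degree →
      (q : ℝ) * P.coeff ℓ ∈ (Int.castRingHom ℝ).range) (x : Fin n → ℤ) :
    MvPolynomial.eval ((fun j => (x j : ℝ)) + Pi.single i (q : ℝ)) P
      - MvPolynomial.eval (fun j => (x j : ℝ)) P - P.coeff (Finsupp.single i 1) * q
      ∈ (Int.castRingHom ℝ).range := by
  have hsum : P.coeff (Finsupp.single i 1) * (q : ℝ) = ∑ ℓ ∈ P.support,
      if ℓ = Finsupp.single i 1 then P.coeff ℓ * (q : ℝ) else 0 := by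
    rw [Finset.sum_ite_eq']
    split_ifs with h
    · rfl
    · rw [MvPolynomial.notMem_support_iff.1 h, zero_mul]
  rw [hsum, MvPolynomial.eval_eq', MvPolynomial.eval_eq', ← Finset.sum_sub_distrib,
    ← Finset.sum_sub_distrib]
  refine sum_mem fun ℓ _ => ?_
  rw [← mul_sub, prod_add_single_pow_sub_prod_pow]
  split_ifs with h
  · subst h
    have : ∏ j ∈ Finset.univ.erase i, (x j : ℝ) ^ (Finsupp.single i 1 : Fin n →₀ ℕ) j = 1 :=
      Finset.prod_eq_one fun j hj => by
        rw [Finsupp.single_eq_of_ne (Finset.ne_of_mem_erase hj), pow_zero]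
    rw [this]
    simp
  · rw [sub_zero]
    by_cases hi : ℓ i = 0
    · simp [hi]
    · have hd : 1 < ℓ.degree := by
        by_contra hle
        exact h (Finsupp.eq_single_of_degree_le_one hi (not_lt.1 hle))
      obtain ⟨w, hw⟩ : (q : ℤ) ∣ (x i + q) ^ ℓ i - x i ^ ℓ i := by
        simpa using sub_dvd_pow_sub_pow (x i + (q : ℤ)) (x i) (ℓ i)
      have hw' : ((x i : ℝ) + q) ^ ℓ i - (x i : ℝ) ^ ℓ i = q * w := by exact_mod_cast hw
      rw [hw', mul_assoc, mul_left_comm, ← mul_assoc]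
      exact mul_mem (hq ℓ hd)
        (mul_mem (intCast_mem _ _) (prod_mem fun _ _ => pow_mem (intCast_mem _ _) _))

lemma tendsto_ballAverage_polyPhase_of_linear {n : ℕ} (P : MvPolynomial (Fin n) ℝ) (i : Fin n)
    (hi : Irrational (P.coeff (Finsupp.single i 1)))
    (hP : ∀ ℓ : Fin n →₀ ℕ, 1 < ℓ.degree → ¬ Irrational (P.coeff ℓ)) :
    Tendsto (ballAverage (polyPhase P)) atTop (𝓝 0) := by
  obtain ⟨q, hq0, hq⟩ := P.exists_common_denominator
  set c : ℂ := (Real.fourierChar (P.coeff (Finsupp.single i 1) * q) : ℂ) with hc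
  have hc1 : c - 1 ≠ 0 := by
    rw [sub_ne_zero, hc, Ne, Circle.coe_eq_one]
    exact fourierChar_ne_one_of_irrational (hi.mul_natCast hq0)
  have hshift : ∀ x, polyPhase P (x + Pi.single i (q : ℤ)) = c * polyPhase P x := by
    intro x
    obtain ⟨z, hz⟩ := P.eval_add_single_sub_eval_sub_mem i (fun ℓ hℓ => hq ℓ (hP ℓ hℓ)) x
    have hz' : MvPolynomial.eval ((fun j => (x j : ℝ)) + Pi.single i (q : ℝ)) P
        = (z : ℝ) + (P.coeff (Finsupp.single i 1) * q
          + MvPolynomial.eval (fun j => (x j : ℝ)) P) := by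
      rw [eq_intCast] at hz
      rw [hz]
      ring
    rw [polyPhase, intCast_add_single, Int.cast_natCast, hz', AddChar.map_add_eq_mul,
      fourierChar_intCast, one_mul, AddChar.map_add_eq_mul, Circle.coe_mul, polyPhase]
  have h := tendsto_ballAverage_add_single_nat i (fun x => (norm_polyPhase P x).le) q
  simp_rw [hshift, ballAverage_const_mul] at h
  have h' := h.const_mul (c - 1)⁻¹
  rw [mul_zero] at h'
  refine h'.congr fun R => ?_
  rw [← sub_one_mul, inv_mul_cancel_left₀ hc1]

/-- **Weyl's theorem** on exponential sums over the integer points of balls, for a polynomial whose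
highest irrational coefficient has degree `d + 1`. -/
theorem tendsto_ballAverage_polyPhase_of_top {n : ℕ} (d : ℕ) :
    ∀ P : MvPolynomial (Fin n) ℝ,
      (∃ ℓ : Fin n →₀ ℕ, ℓ.degree = d + 1 ∧ Irrational (P.coeff ℓ)) →
      (∀ ℓ : Fin n →₀ ℕ, d + 1 < ℓ.degree → ¬ Irrational (P.coeff ℓ)) →
      Tendsto (ballAverage (polyPhase P)) atTop (𝓝 0) := by
  have hcoord : ∀ ℓ : Fin n →₀ ℕ, ℓ.degree ≠ 0 → ∃ i, ℓ i ≠ 0 := fun ℓ h => by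
    by_contra! h0
    exact h (by rw [Finsupp.degree_eq_sum]; simp [h0])
  induction d with
  | zero =>
    rintro P ⟨ℓ, hd, hℓ⟩ hP
    obtain ⟨i, hi⟩ := hcoord ℓ (by omega)
    rw [Finsupp.eq_single_of_degree_le_one hi (by omega)] at hℓ
    exact tendsto_ballAverage_polyPhase_of_linear P i hℓ hP
  | succ d ih =>
    rintro P ⟨ℓ, hd, hℓ⟩ hP
    obtain ⟨i, hi⟩ := hcoord ℓ (by omega)
    refine tendsto_ballAverage_zero_of_differences i (norm_polyPhase P) fun s t hst => ?_
    have hst' : ((s : ℤ) - t) ≠ 0 := by omega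
    simp_rw [polyPhase_mul_conj]
    have h1 := ih (P.directionalDifference i (((s : ℤ) - t : ℤ) : ℝ))
      ⟨ℓ.update i (ℓ i - 1), ?_,
        MvPolynomial.irrational_coeff_directionalDifference i hst' hP hd hi hℓ⟩
      (fun m hm => MvPolynomial.not_irrational_coeff_directionalDifference i _ hP hm)
    -- The correlation is the phase of the difference at a point shifted by `t`; shift invariance
    -- removes that shift.
    · have h2 := (tendsto_ballAverage_add_single_nat i (fun x => (norm_polyPhase
        (P.directionalDifference i (((s : ℤ) - t : ℤ) : ℝ)) x).le) t).add h1
      rw [add_zero] at h2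
      exact h2.congr fun R => sub_add_cancel _ _
    · have := Finsupp.degree_update_add ℓ i (ℓ i - 1)
      omega

/-- **Weyl's theorem** on exponential sums over the integer points of balls. -/
theorem tendsto_ballAverage_polyPhase {n : ℕ} (P : MvPolynomial (Fin n) ℝ)
    (hP : ∃ ℓ : Fin n →₀ ℕ, 0 < ℓ.degree ∧ Irrational (P.coeff ℓ)) :
    Tendsto (ballAverage (polyPhase P)) atTop (𝓝 0) := by
  classical
  obtain ⟨ℓ₀, h0, hℓ₀⟩ := hP
  have hmem : ∀ ℓ : Fin n →₀ ℕ, Irrational (P.coeff ℓ) → ℓ ∈ P.support := fun ℓ h =>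
    MvPolynomial.mem_support_iff.2 fun h' => by simp [h'] at h
  obtain ⟨ℓ, hℓ, hmax⟩ := Finset.exists_max_image
    (P.support.filter fun ℓ => Irrational (P.coeff ℓ)) Finsupp.degree
    ⟨ℓ₀, Finset.mem_filter.2 ⟨hmem _ hℓ₀, hℓ₀⟩⟩
  have hle : ℓ₀.degree ≤ ℓ.degree := hmax _ (Finset.mem_filter.2 ⟨hmem _ hℓ₀, hℓ₀⟩)
  -- The truncated subtraction is harmless: `ℓ.degree ≥ ℓ₀.degree > 0`.
  refine tendsto_ballAverage_polyPhase_of_top (ℓ.degree - 1) P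
    ⟨ℓ, by omega, (Finset.mem_filter.1 hℓ).2⟩ fun m hm hirr => ?_
  have := hmax m (Finset.mem_filter.2 ⟨hmem _ hirr, hirr⟩)
  omega

/-! ### From ball averages to weak convergence of measures -/

/-- An integer point as a point of Euclidean space. -/
def latticeEmbedding (n : ℕ) : (Fin n → ℤ) ↪ EuclideanSpace ℝ (Fin n) where
  toFun x := WithLp.toLp 2 fun j => (x j : ℝ)
  inj' x y h := by
    ext j
    have := congrArg (fun z : EuclideanSpace ℝ (Fin n) => z j) h
    simpa using this

lemma latticeEmbedding_apply {n : ℕ} (x : Fin n → ℤ) (j : Fin n) :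
    latticeEmbedding n x j = (x j : ℝ) := rfl

lemma latticeBall_eq {n : ℕ} {R : ℝ} (hR : 0 < R) :
    latticeBall n R = ((ballPoints n R).map (latticeEmbedding n) : Set _) := by
  have key : ∀ x : Fin n → ℤ, latticeEmbedding n x ∈ Metric.ball 0 R ↔ x ∈ ballPoints n R := by
    intro x
    rw [mem_ballPoints hR.le, mem_ball_zero_iff, EuclideanSpace.norm_eq,
      Real.sqrt_lt' hR]
    simp [latticeEmbedding_apply]
  ext y
  simp only [latticeBall, Set.mem_ofPred_eq, Finset.coe_map, Set.mem_image, Finset.mem_coe]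
  constructor
  · rintro ⟨hy, h⟩
    choose m hm using h
    have hym : latticeEmbedding n m = y := by
      ext j
      simp [latticeEmbedding_apply, hm j]
    exact ⟨m, (key m).1 (hym ▸ hy), hym⟩
  · rintro ⟨x, hx, rfl⟩
    exact ⟨(key x).2 hx, fun j => ⟨x j, rfl⟩⟩

lemma integral_latticeMeasure {n : ℕ} {R : ℝ} (hR : 0 < R) (g : EuclideanSpace ℝ (Fin n) → ℂ) :
    ∫ y, g y ∂(latticeMeasure n R : Measure (EuclideanSpace ℝ (Fin n)))
      = ballAverage (fun x => g (latticeEmbedding n x)) R := by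
  change ∫ y, g y ∂(ProbabilityTheory.uniformOn (latticeBall n R)) = _
  -- On finitely many atoms integrability is automatic, so `g` needs no regularity.
  have hfin : IntegrableOn g ((ballPoints n R).map (latticeEmbedding n)) Measure.count := by
    rw [← Set.biUnion_of_singleton
      (((ballPoints n R).map (latticeEmbedding n) : Finset _) : Set (EuclideanSpace ℝ (Fin n)))]
    exact integrableOn_finset_iUnion.2 fun x _ => (integrableOn_singleton_iff (by finiteness)).2 (Or.inr (by simp))
  rw [ProbabilityTheory.uniformOn, ProbabilityTheory.cond, integral_smul_measure,
    latticeBall_eq hR, setIntegral_finset _ hfin, Measure.count_apply_finset]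
  simp [ballAverage, Measure.real]

lemma measurable_modOne_polyFun {n : ℕ} (P : MvPolynomial (Fin n) ℝ) :
    Measurable (modOne (polyFun P)) := by
  have h : Continuous (polyFun P) := by
    unfold polyFun
    exact (MvPolynomial.continuous_eval P).comp (by fun_prop)
  have h' : Continuous (modOne (polyFun P)) := (AddCircle.continuous_mk' 1).comp h
  exact h'.measurable

lemma integral_map_latticeMeasure {n : ℕ} {R : ℝ} (hR : 0 < R) (P : MvPolynomial (Fin n) ℝ)
    (g : C(UnitAddCircle, ℂ)) :
    ∫ z, g z ∂((latticeMeasure n R).map (modOne (polyFun P)) : Measure UnitAddCircle)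
      = ballAverage (fun x : Fin n → ℤ =>
        g ((MvPolynomial.eval (fun j => (x j : ℝ)) P : ℝ) : UnitAddCircle)) R := by
  rw [FiniteMeasure.toMeasure_map, integral_map (measurable_modOne_polyFun P).aemeasurable
    g.continuous.aestronglyMeasurable, integral_latticeMeasure hR]
  rfl

lemma integral_fourier_haarAddCircle (k : ℤ) :
    ∫ z, fourier k z ∂(AddCircle.haarAddCircle : Measure UnitAddCircle) = if k = 0 then 1 else 0 := by
  have h := congrFun (fourierCoeff_fourier (T := 1) k) 0
  rw [fourierCoeff] at h
  simpa [Pi.single_apply, eq_comm] using h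

lemma fourier_eval_eq_polyPhase {n : ℕ} (k : ℤ) (P : MvPolynomial (Fin n) ℝ) (x : Fin n → ℤ) :
    fourier k ((MvPolynomial.eval (fun j => (x j : ℝ)) P : ℝ) : UnitAddCircle)
      = polyPhase (MvPolynomial.C (k : ℝ) * P) x := by
  rw [fourier_coe_apply, polyPhase, Real.fourierChar_apply, map_mul, MvPolynomial.eval_C]
  congr 1
  push_cast
  ring

/-- **Weyl's criterion** for averages over the integer points of balls. -/
lemma tendsto_ballAverage_of_fourier {n : ℕ} (F : (Fin n → ℤ) → UnitAddCircle)
    (hF : ∀ k : ℤ, k ≠ 0 → Tendsto (ballAverage fun x => fourier k (F x)) atTop (𝓝 0))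
    (g : C(UnitAddCircle, ℂ)) :
    Tendsto (ballAverage fun x => g (F x)) atTop
      (𝓝 (∫ z, g z ∂(AddCircle.haarAddCircle : Measure UnitAddCircle))) := by
  have hint : ∀ h : C(UnitAddCircle, ℂ),
      Integrable h (AddCircle.haarAddCircle : Measure UnitAddCircle) := fun h =>
    h.continuous.integrable_of_hasCompactSupport (HasCompactSupport.of_compactSpace h)
  have hspan : ∀ h ∈ Submodule.span ℂ (Set.range (fourier : ℤ → C(UnitAddCircle, ℂ))),
      Tendsto (ballAverage fun x => h (F x)) atTop
        (𝓝 (∫ z, h z ∂(AddCircle.haarAddCircle : Measure UnitAddCircle))) := by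
    intro h hh
    induction hh using Submodule.span_induction with
    | mem h hmem =>
      obtain ⟨k, rfl⟩ := hmem
      rw [integral_fourier_haarAddCircle]
      split_ifs with hk
      · subst hk
        refine tendsto_const_nhds.congr' ?_
        filter_upwards [eventually_gt_atTop 0] with R hR
        simp only [fourier_zero]
        rw [ballAverage_const _ hR]
      · exact hF k hk
    | zero =>
      have h0 : (ballAverage fun x : Fin n → ℤ => (0 : C(UnitAddCircle, ℂ)) (F x)) = 0 := by
        ext R
        simp [ballAverage]
      rw [h0]
      simp only [ContinuousMap.zero_apply, integral_zero]
      exact tendsto_const_nhds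
    | add u v _ _ hu hv =>
      simp only [ContinuousMap.add_apply]
      rw [integral_add (hint u) (hint v)]
      refine (hu.add hv).congr fun R => ?_
      simp only [ballAverage, Finset.sum_add_distrib, mul_add]
    | smul a u _ hu =>
      simp only [ContinuousMap.smul_apply, smul_eq_mul]
      rw [integral_const_mul]
      refine (hu.const_mul a).congr fun R => (ballAverage_const_mul _ _ _).symm
  -- Trigonometric polynomials are uniformly dense, and both the average and the integral are
  -- contractions for the sup norm: an `ε / 3` argument.
  rw [Metric.tendsto_nhds]
  intro ε hε
  have hg : g ∈ (Submodule.span ℂ (Set.range (fourier : ℤ → C(UnitAddCircle, ℂ)))).topologicalClosure := by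
    rw [span_fourier_closure_eq_top]
    trivial
  obtain ⟨h, hh, hgh⟩ := Metric.mem_closure_iff.1 hg (ε / 3) (by positivity)
  have hpt : ∀ z, ‖g z - h z‖ ≤ ε / 3 := fun z => by
    rw [← dist_eq_norm]
    exact (ContinuousMap.dist_apply_le_dist z).trans hgh.le
  filter_upwards [(Metric.tendsto_nhds.1 (hspan h hh)) (ε / 3) (by positivity),
    eventually_gt_atTop 0] with R hR1 hR
  have h1 : dist (ballAverage (fun x => g (F x)) R) (ballAverage (fun x => h (F x)) R) ≤ ε / 3 := by
    have hc : (0 : ℝ) < (ballPoints n R).card := by exact_mod_cast ballPoints_card_pos hR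
    rw [dist_eq_norm]
    simp only [ballAverage]
    rw [← mul_sub, ← Finset.sum_sub_distrib, norm_mul, norm_inv, Complex.norm_natCast,
      inv_mul_le_iff₀ hc]
    simpa using norm_sum_le_of_le (ballPoints n R) fun x _ => hpt (F x)
  have h2 : dist (∫ z, h z ∂(AddCircle.haarAddCircle : Measure UnitAddCircle))
      (∫ z, g z ∂(AddCircle.haarAddCircle : Measure UnitAddCircle)) ≤ ε / 3 := by
    rw [dist_comm, dist_eq_norm, ← integral_sub (hint g) (hint h)]
    simpa using norm_integral_le_of_norm_le_const (Eventually.of_forall hpt)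
      (μ := (AddCircle.haarAddCircle : Measure UnitAddCircle))
  have h3 := dist_triangle4 (ballAverage (fun x => g (F x)) R) (ballAverage (fun x => h (F x)) R)
    (∫ z, h z ∂(AddCircle.haarAddCircle : Measure UnitAddCircle))
    (∫ z, g z ∂(AddCircle.haarAddCircle : Measure UnitAddCircle))
  linarith

theorem theorem1p2 (n : ℕ) (P : MvPolynomial (Fin n) ℝ)
    (hP : ∃ ℓ : Fin n →₀ ℕ, 0 < ℓ.degree ∧ Irrational (P.coeff ℓ)) :
    EquidistributedModOne (polyFun P) := by
  -- Complex test functions allow the characters to be used directly.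
  rw [EquidistributedModOne, FiniteMeasure.tendsto_iff_forall_integral_rclike_tendsto ℂ]
  intro g
  have h := tendsto_ballAverage_of_fourier
    (fun x : Fin n → ℤ => ((MvPolynomial.eval (fun j => (x j : ℝ)) P : ℝ) : UnitAddCircle))
    (fun k hk => by
      simp_rw [fourier_eval_eq_polyPhase]
      obtain ⟨ℓ, hd, hℓ⟩ := hP
      refine tendsto_ballAverage_polyPhase _ ⟨ℓ, hd, ?_⟩
      rw [MvPolynomial.coeff_C_mul]
      exact hℓ.intCast_mul hk) g.toContinuousMap
  refine h.congr' ?_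
  filter_upwards [eventually_gt_atTop 0] with R hR
  exact (integral_map_latticeMeasure hR P g.toContinuousMap).symm
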